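/- **Conventions.** Let $\Sigma$ be a finite alphabet. A quantum automaton over $\Sigma$ is a tuple $\mathcal A=(\mathcal H,|s_0\rangle,\Sigma,\{U_\sigma\}_{\sigma\in\Sigma},F)$ with $\mathcal H$ a finite-dimensional complex Hilbert space, $|s_0\rangle\in\mathcal H$ a unit vector, each $U_\sigma$ a unitary operator on $\mathcal H$, and $F$ a subspace of $\mathcal H$. Its non-disturbing run over $w=\sigma_1\sigma_2\cdots\in\Sigma^\omega$ is $|s_0\rangle,|s_1\rangle,\dots$ with $|s_n\rangle=U_{\sigma_n}|s_{n-1}\rangle$ for $n\ge 1$, and $$f^{\mathrm{ND}}_{\mathcal A}(w)=\sup_{|\psi\rangle\in F,\ \|\psi\|=1}\ \sup_{0\le n_1<n_2<\cdots}\ \inf_{i\ge 1}|\langle\psi|s_{n_i}\rangle|^2,$$ where the supremum over the empty set (the case $F=0$) is $0$. Put $\mathcal L^{>\lambda}(\mathcal A|\mathrm{ND})=\{w\in\Sigma^\omega : f^{\mathrm{ND}}_{\mathcal A}(w)>\lambda\}$ and $\mathcal L^{=1}(\mathcal A|\mathrm{ND})=\{w\in\Sigma^\omega : f^{\mathrm{ND}}_{\mathcal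 A}(w)=1\}$, and let $\mathbb L^{>\lambda}(\mathrm{QBA}|\mathrm{ND})$ and $\mathbb L^{=1}(\mathrm{QBA}|\mathrm{ND})$ be the classes of all $\omega$-languages of these two forms, with $\mathcal A$ ranging over all quantum automata. For $V\subseteq\Sigma^*$ let $V^\omega$ be the set of infinite words $v_1v_2v_3\cdots$ with all $v_i\in V\setminus\{\epsilon\}$. Let $\omega\text{-}\mathrm{RL}$ (respectively $\omega\text{-}\mathrm{CFL}$) be the class of all finite unions $\bigcup_{i=1}^n U_iV_i^\omega$ with all $U_i,V_i\subseteq\Sigma^*$ regular (respectively context-free). **Theorem.** 1. There is a language $L\in\omega\text{-}\mathrm{RL}$ (over some finite alphabet) such that $L\notin\mathbb L^{>\lambda}(\mathrm{QBA}|\mathrm{ND})$ for every $\lambda\in[0,1)$. In particular $\omega\text{-}\mathrm{RL}\not\subseteq\mathbb L^{>\lambda}(\mathrm{QBA}|\mathrm{ND})$ for every $\lambda\in[0,1)$. 2. There is a language $L\in\omega\text{-}\mathrm{CFL}\setminus\omega\text{-}\mathrm{RL}$ such that $L\notin\mathbb L^{>\lambda}(\mathrm{QBA}|\mathrm{ND})$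 for every $\lambda\in[0,1)$. In particular $\omega\text{-}\mathrm{CFL}\setminus\omega\text{-}\mathrm{RL}\not\subseteq\mathbb L^{>\lambda}(\mathrm{QBA}|\mathrm{ND})$ for every $\lambda\in[0,1)$. 3. For every $\lambda\in(0,1)$, $\mathbb L^{>\lambda}(\mathrm{QBA}|\mathrm{ND})\not\subseteq\omega\text{-}\mathrm{RL}$. 4. $\mathbb L^{=1}(\mathrm{QBA}|\mathrm{ND})\not\subseteq\omega\text{-}\mathrm{RL}$. 5. $\mathbb L^{=1}(\mathrm{QBA}|\mathrm{ND})\not\subseteq\omega\text{-}\mathrm{CFL}$; moreover there is a language in $\mathbb L^{=1}(\mathrm{QBA}|\mathrm{ND})$ that is neither $\omega$-regular nor $\omega$-context-free. -/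

import Mathlib

open scoped ComplexInnerProductSpace

/-- An infinite word `σ₁ σ₂ σ₃ …` over the alphabet `α`; its `n`-th letter, counted from `0`,
is `w n`. -/
abbrev OmegaWord (α : Type) : Type := ℕ → α

/-- A set of infinite words over `α`. -/
abbrev OmegaLanguage (α : Type) : Type := Set (OmegaWord α)

namespace OmegaWord

/-- The finite factor of `w` that consists of the letters at the positions `m ≤ i < n`. -/
def factor {α : Type} (w : OmegaWord α) (m n : ℕ) : List α :=
  (List.range' m (n - m)).map w

/-- The infinite word that remains of `w` when its first `m` letters are removed. -/
def drop {α : Type} (w : OmegaWord α) (m : ℕ) : OmegaWord α := fun i => w (m + i)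

end OmegaWord

/-- The `ω`-power `V^ω`: all infinite words `v₁ v₂ v₃ …` with every `vᵢ` a nonempty word of `V`.
The strictly increasing sequence `k` lists the positions at which the words `vᵢ` start. -/
def omegaPower {α : Type} (V : Language α) : OmegaLanguage α :=
  {w | ∃ k : ℕ → ℕ, StrictMono k ∧ k 0 = 0 ∧ ∀ i, w.factor (k i) (k (i + 1)) ∈ V}

/-- The concatenation `U X` of a language `U` of finite words and an `ω`-language `X`. -/
def omegaConcat {α : Type} (U : Language α) (X : OmegaLanguage α) : OmegaLanguage α :=
  {w | ∃ m : ℕ, w.factor 0 m ∈ U ∧ w.drop m ∈ X}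

/-- The `ω`-Kleene closure of a class `C` of languages of finite words: all finite unions
`⋃ᵢ Uᵢ Vᵢ^ω` with `Uᵢ, Vᵢ` in `C`. -/
def omegaKleeneClosure {α : Type} (C : Set (Language α)) : Set (OmegaLanguage α) :=
  {L | ∃ (n : ℕ) (U V : Fin n → Language α), (∀ i, U i ∈ C) ∧ (∀ i, V i ∈ C) ∧
    L = ⋃ i, omegaConcat (U i) (omegaPower (V i))}

/-- The class `ω-RL` of `ω`-regular languages over `α`. -/
def omegaRL (α : Type) : Set (OmegaLanguage α) :=
  omegaKleeneClosure {L : Language α | L.IsRegular}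

/-- The class `ω-CFL` of `ω`-context-free languages over `α`. -/
def omegaCFL (α : Type) : Set (OmegaLanguage α) :=
  omegaKleeneClosure {L : Language α | L.IsContextFree}

/-- A quantum automaton over the alphabet `α` with state space `H`. -/
structure QuantumAutomaton (α H : Type) [NormedAddCommGroup H] [InnerProductSpace ℂ H] where
  /-- the initial pure state -/
  init : H
  norm_init : ‖init‖ = 1
  /-- the unitary operator of each letter -/
  U : α → (H ≃ₗᵢ[ℂ] H)
  /-- the space of accepting states -/
  F : Submodule ℂ H

namespace QuantumAutomaton

variable {α H : Type} [NormedAddCommGroup H] [InnerProductSpace ℂ H]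

/-- The non-disturbing run `s₀, s₁, s₂, …` of the automaton over `w`. -/
def run (A : QuantumAutomaton α H) (w : OmegaWord α) : ℕ → H
  | 0 => A.init
  | n + 1 => A.U (w n) (A.run w n)

/-- The probability that `w` is non-disturbingly Büchi accepted: the supremum over the pure states
`ψ` in `F` and over the sequences `n₀ < n₁ < …` of checkpoints of `inf_i |⟨ψ, s_{n_i}⟩|²`.
All the numbers lie in `[0, 1]`; if `F` is zero, the supremum is that of the empty set in `[0, 1]`,
namely `0`. -/
noncomputable def acceptND (A : QuantumAutomaton α H) (w : OmegaWord α) : ℝ :=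
  ⨆ ψ : {ψ : H // ψ ∈ A.F ∧ ‖ψ‖ = 1}, ⨆ n : {n : ℕ → ℕ // StrictMono n},
    ⨅ i : ℕ, ‖⟪(ψ : H), A.run w ((n : ℕ → ℕ) i)⟫‖ ^ 2

/-- The language `𝓛^{>c}(A|ND)` (for `c = 0`, the probable semantics). -/
def strictThresholdLanguageND (A : QuantumAutomaton α H) (c : ℝ) : OmegaLanguage α :=
  {w | c < A.acceptND w}

/-- The language `𝓛^{=1}(A|ND)`. -/
def almostSureLanguageND (A : QuantumAutomaton α H) : OmegaLanguage α :=
  {w | A.acceptND w = 1}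

end QuantumAutomaton

/-- The class `𝕃^{>c}(QBA|ND)` over the alphabet `α`; the automata range over all
finite-dimensional complex Hilbert spaces. -/
def strictThresholdClassND (α : Type) (c : ℝ) : Set (OmegaLanguage α) :=
  {L | ∃ (H : Type) (_ : NormedAddCommGroup H) (_ : InnerProductSpace ℂ H)
    (_ : FiniteDimensional ℂ H) (A : QuantumAutomaton α H), L = A.strictThresholdLanguageND c}

/-- The class `𝕃^{=1}(QBA|ND)` over the alphabet `α`. -/
def almostSureClassND (α : Type) : Set (OmegaLanguage α) :=
  {L | ∃ (H : Type) (_ : NormedAddCommGroup H) (_ : InnerProductSpace ℂ H)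
    (_ : FiniteDimensional ℂ H) (A : QuantumAutomaton α H), L = A.almostSureLanguageND}

/-! Two principles separate the classes.

Recurrence limits strict thresholds. On the compact unit sphere the powers of one unitary `U_b`
bring the initial state back arbitrarily close to itself, and the letters read afterwards preserve
this distance. If `w` is accepted with probability above `c`, then for some `k > 0` the word `bᵏw`
is accepted as well, since the displacement fits into the slack of the strict inequality
(`exists_lt_acceptND_append_replicate`). The language `{aaa…}` and the language of the words
`aⁿbⁿaaa…` both contain `aaa…` but no `bᵏaaa…` with `k > 0`, which gives 1 and 2.

Phases count letters. In `phaseAutomaton` each letter turns the phase of its own coordinate by `z`,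
an irrational rotation, and an idle letter freezes the state, so `u` followed by idle letters is
accepted with probability `|(∑ᵢ z^(uᵢ)) / |ι||²`, where `uᵢ` counts the `i`-th letter. With two
letters this depends on the difference of the counts and is dense along every arithmetic
progression, whereas the finite left congruence of an `ω`-regular language would force periodicity;
this gives 3. With three letters, probability `1` means equal counts, and 4 follows from the same
congruence. For 5, factors coming from subtrees of derivation trees fall into finitely many
interchangeable classes, so two factors of very different size share a class. Exchanging them in
`aⁿbⁿcⁿ` must keep the counts equal, so the larger factor meets both `a` and `c` and contains all
the letters `b`, more than its size allows. -/

/-! ### Prefixes and factors of infinite words -/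

namespace OmegaWord

variable {α : Type}

/-- The infinite word `u w`. -/
def append : List α → OmegaWord α → OmegaWord α
  | [], w => w
  | a :: u, w => fun n => Nat.casesOn n a (append u w)

@[simp] lemma nil_append (w : OmegaWord α) : append [] w = w := rfl

@[simp] lemma cons_append_zero (a : α) (u : List α) (w : OmegaWord α) :
    append (a :: u) w 0 = a := rfl

@[simp] lemma cons_append_succ (a : α) (u : List α) (w : OmegaWord α) (n : ℕ) :
    append (a :: u) w (n + 1) = append u w n := rfl

lemma append_append (u v : List α) (w : OmegaWord α) :
    append (u ++ v) w = append u (append v w) := by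
  induction u with
  | nil => rfl
  | cons a u ih =>
    funext n
    cases n with
    | zero => rfl
    | succ n => simp [ih]

lemma append_apply_add (u : List α) (w : OmegaWord α) (i : ℕ) :
    append u w (u.length + i) = w i := by
  induction u with
  | nil => simp
  | cons a u ih =>
    rw [List.length_cons, Nat.add_right_comm, cons_append_succ, ih]

lemma append_apply_lt (u : List α) (w : OmegaWord α) {i : ℕ} (hi : i < u.length) :
    append u w i = u[i] := by
  induction u generalizing i with
  | nil => simp at hi
  | cons a u ih =>
    cases i with
    | zero => rfl
    | succ n => simpa using ih (by simpa using hi)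

@[simp] lemma drop_append (u : List α) (w : OmegaWord α) : (append u w).drop u.length = w := by
  funext i
  exact append_apply_add u w i

@[simp] lemma length_factor (w : OmegaWord α) (m n : ℕ) : (w.factor m n).length = n - m := by
  simp [factor]

lemma getElem_factor (w : OmegaWord α) {m n i : ℕ} (hi : i < (w.factor m n).length) :
    (w.factor m n)[i] = w (m + i) := by
  simp [factor]

lemma factor_append_factor (w : OmegaWord α) {m n p : ℕ} (hmn : m ≤ n) (hnp : n ≤ p) :
    w.factor m n ++ w.factor n p = w.factor m p := by
  obtain ⟨a, rfl⟩ := Nat.exists_eq_add_of_le hmn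
  obtain ⟨b, rfl⟩ := Nat.exists_eq_add_of_le hnp
  simp only [factor, Nat.add_sub_cancel_left, ← List.map_append]
  rw [add_assoc m a b, Nat.add_sub_cancel_left, List.range'_append_1]

lemma factor_drop (w : OmegaWord α) (m a b : ℕ) :
    (w.drop m).factor a b = w.factor (m + a) (m + b) := by
  apply List.ext_getElem
  · simp; omega
  · intro i h₁ h₂
    rw [getElem_factor, getElem_factor]
    simp [drop, add_assoc]

lemma factor_append (u : List α) (w : OmegaWord α) : (append u w).factor 0 u.length = u := by
  apply List.ext_getElem
  · simp
  · intro i h₁ h₂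
    rw [getElem_factor, zero_add, append_apply_lt]

lemma factor_append_add (u : List α) (w : OmegaWord α) (a b : ℕ) :
    (append u w).factor (u.length + a) (u.length + b) = w.factor a b := by
  rw [← factor_drop, drop_append]

lemma append_factor_drop (w : OmegaWord α) (m : ℕ) : append (w.factor 0 m) (w.drop m) = w := by
  funext i
  by_cases hi : i < m
  · rw [append_apply_lt _ _ (by simpa using hi), getElem_factor, zero_add]
  · obtain ⟨j, rfl⟩ := Nat.exists_eq_add_of_le (not_lt.1 hi)
    have := append_apply_add (w.factor 0 m) (w.drop m) j
    simpa [drop] using this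

lemma append_injective (u : List α) {w w' : OmegaWord α} (h : append u w = append u w') :
    w = w' := by
  rw [← drop_append u w, h, drop_append]

/-- If two factorizations `u w` and `v w'` of an infinite word have `u` not longer than `v`, then
`u` is a prefix of `v`. -/
lemma exists_of_append_eq {u v : List α} {w w' : OmegaWord α} (h : append u w = append v w')
    (hl : u.length ≤ v.length) : ∃ y, v = u ++ y ∧ w = append y w' := by
  have hu : v.take u.length = u := by
    apply List.ext_getElem
    · simp [hl]
    · intro i h₁ h₂
      rw [List.getElem_take, ← append_apply_lt v w' (by omega), ← h, append_apply_lt]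
  have hv : v = u ++ v.drop u.length := by
    conv_lhs => rw [← List.take_append_drop u.length v, hu]
  refine ⟨v.drop u.length, hv, ?_⟩
  rw [hv, append_append] at h
  exact append_injective u h

end OmegaWord

open OmegaWord

/-! ### `ω`-powers and the left congruence of `ω`-regular languages -/

section Omega

variable {α : Type}

lemma mem_omegaConcat {U : Language α} {X : OmegaLanguage α} {w : OmegaWord α} :
    w ∈ omegaConcat U X ↔ ∃ u ∈ U, ∃ x ∈ X, append u x = w := by
  constructor
  · rintro ⟨m, hu, hx⟩
    exact ⟨_, hu, _, hx, append_factor_drop w m⟩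
  · rintro ⟨u, hu, x, hx, rfl⟩
    exact ⟨u.length, by rwa [factor_append], by rwa [drop_append]⟩

lemma append_mem_omegaPower {V : Language α} {v : List α} {w : OmegaWord α} (hv : v ∈ V)
    (hw : w ∈ omegaPower V) : append v w ∈ omegaPower V := by
  rcases eq_or_ne v [] with rfl | hne
  · exact hw
  obtain ⟨k, hk, hk0, hkV⟩ := hw
  refine ⟨fun i => Nat.casesOn i 0 (fun j => v.length + k j), ?_, rfl, ?_⟩
  · apply strictMono_nat_of_lt_succ
    rintro (_ | n)
    · simpa [hk0] using List.length_pos_iff.2 hne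
    · simpa using hk n.lt_succ_self
  · rintro (_ | n)
    · simpa [hk0, factor_append] using hv
    · simpa [factor_append_add] using hkV n

lemma exists_of_mem_omegaPower {V : Language α} {w : OmegaWord α} (hw : w ∈ omegaPower V) :
    ∃ v ∈ V, v ≠ [] ∧ ∃ w' ∈ omegaPower V, append v w' = w := by
  obtain ⟨k, hk, hk0, hkV⟩ := hw
  have hle : ∀ i, k 1 ≤ k (i + 1) := fun i => hk.monotone (by omega)
  refine ⟨w.factor 0 (k 1), by simpa [hk0] using hkV 0, ?_, w.drop (k 1),
    ⟨fun i => k (i + 1) - k 1, ?_, by simp, ?_⟩, append_factor_drop _ _⟩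
  · have := hk zero_lt_one
    rw [← List.length_pos_iff, length_factor]
    omega
  · apply strictMono_nat_of_lt_succ
    intro n
    have := hk (Nat.lt_succ_self (n + 1))
    have := hle n
    simp only [Nat.succ_eq_add_one] at *
    omega
  · intro i
    rw [factor_drop, Nat.add_sub_cancel' (hle i), Nat.add_sub_cancel' (hle (i + 1))]
    exact hkV (i + 1)

lemma append_mem_omegaPower_of_mem_kstar {V : Language α} {v : List α} {w : OmegaWord α}
    (hv : v ∈ KStar.kstar V) (hw : w ∈ omegaPower V) : append v w ∈ omegaPower V := by
  obtain ⟨l, rfl, hl⟩ := Language.mem_kstar.1 hv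
  induction l with
  | nil => exact hw
  | cons a l ih =>
    rw [List.flatten_cons, append_append]
    have hl' : ∀ y ∈ l, y ∈ V := fun y hy => hl y (List.mem_cons_of_mem _ hy)
    exact append_mem_omegaPower (hl a List.mem_cons_self) (ih hl' (Language.join_mem_kstar hl'))

lemma append_mem_kstar {V : Language α} {x y : List α} (hx : x ∈ KStar.kstar V)
    (hy : y ∈ KStar.kstar V) : x ++ y ∈ KStar.kstar V := by
  obtain ⟨l, rfl, hl⟩ := Language.mem_kstar.1 hx
  obtain ⟨l', rfl, hl'⟩ := Language.mem_kstar.1 hy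
  rw [← List.flatten_append]
  exact Language.join_mem_kstar (by simpa [or_imp, forall_and] using ⟨hl, hl'⟩)

lemma mem_kstar_self {V : Language α} {x : List α} (hx : x ∈ V) : x ∈ KStar.kstar V := by
  have := Language.join_mem_kstar (l := V) (L := [x]) (by simpa using hx)
  simpa using this

/-- A nonempty prefix of a word of `V^ω` ends inside one of the words of `V`. -/
lemma exists_split_of_append_mem_omegaPower {V : Language α} {r : List α} {w : OmegaWord α}
    (h : append r w ∈ omegaPower V) :
    ∃ s ∈ KStar.kstar V, ∃ v y w', r = s ++ v ∧ w = append y w' ∧ w' ∈ omegaPower V ∧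
      v ++ y ∈ V := by
  induction hn : r.length using Nat.strong_induction_on generalizing r with
  | _ n ih =>
    obtain ⟨v, hv, hne, w', hw', he⟩ := exists_of_mem_omegaPower h
    rcases le_total r.length v.length with hl | hl
    · obtain ⟨y, rfl, rfl⟩ := exists_of_append_eq he.symm hl
      exact ⟨[], Language.nil_mem_kstar V, r, y, w', rfl, rfl, hw', hv⟩
    · obtain ⟨y, rfl, rfl⟩ := exists_of_append_eq he hl
      have hpos := List.length_pos_iff.2 hne
      obtain ⟨s, hs, v', y', w'', rfl, rfl, hw'', hV⟩ :=
        ih y.length (by rw [← hn, List.length_append]; omega) hw' rfl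
      exact ⟨v ++ s, append_mem_kstar (mem_kstar_self hv) hs, v', y', w'', by simp, rfl, hw'', hV⟩

/-- What matters about a prefix `u` is finite data. If `u` ends inside the factor from `U`, it is
the state of an automaton for `U`; otherwise it is the state of an automaton for `V` inside the
factor where `u` ends. The second component of the profile collects these states over all ways to
cut `u`. -/
lemma exists_finite_profile_omegaConcat {U V : Language α} (hU : U.IsRegular) (hV : V.IsRegular) :
    ∃ (K : Type) (_ : Finite K) (φ : List α → K), ∀ u u' w, φ u = φ u' →
      append u w ∈ omegaConcat U (omegaPower V) → append u' w ∈ omegaConcat U (omegaPower V) := by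
  obtain ⟨σ, _, A, rfl⟩ := Language.isRegular_iff.{0}.1 hU
  obtain ⟨τ, _, B, rfl⟩ := Language.isRegular_iff.{0}.1 hV
  refine ⟨σ × Set τ, inferInstance, fun u => (A.eval u,
    {q | ∃ x ∈ A.accepts, ∃ s ∈ KStar.kstar B.accepts, ∃ v, u = x ++ (s ++ v) ∧ q = B.eval v}),
    ?_⟩
  intro u u' w hφ h
  obtain ⟨hA, hB⟩ := Prod.ext_iff.1 hφ
  simp only at hA hB
  obtain ⟨x, hx, w₀, hw₀, he⟩ := mem_omegaConcat.1 h
  rcases le_total u.length x.length with hl | hl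
  · obtain ⟨y, rfl, rfl⟩ := exists_of_append_eq he.symm hl
    refine mem_omegaConcat.2 ⟨u' ++ y, ?_, w₀, hw₀, append_append _ _ _⟩
    rw [DFA.mem_accepts, DFA.eval, DFA.evalFrom_of_append] at hx ⊢
    change A.evalFrom A.start u = A.evalFrom A.start u' at hA
    rwa [← hA]
  · obtain ⟨r, rfl, rfl⟩ := exists_of_append_eq he hl
    obtain ⟨s, hs, v, y, w', rfl, rfl, hw', hvy⟩ := exists_split_of_append_mem_omegaPower hw₀
    have hq : B.eval v ∈ {q | ∃ x ∈ A.accepts, ∃ s ∈ KStar.kstar B.accepts, ∃ v,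
        u' = x ++ (s ++ v) ∧ q = B.eval v} := by
      rw [← hB]
      exact ⟨x, hx, s, hs, v, rfl, rfl⟩
    obtain ⟨x', hx', s', hs', v', rfl, hv'⟩ := hq
    have hvy' : v' ++ y ∈ B.accepts := by
      rw [DFA.mem_accepts, DFA.eval, DFA.evalFrom_of_append] at hvy ⊢
      change B.evalFrom B.start v = B.evalFrom B.start v' at hv'
      rwa [← hv']
    refine mem_omegaConcat.2 ⟨x', hx', append s' (append (v' ++ y) w'), ?_, ?_⟩
    · exact append_mem_omegaPower_of_mem_kstar hs' (append_mem_omegaPower hvy' hw')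
    · simp [append_append]

/-- The left congruence of an `ω`-regular language has finite index. -/
lemma exists_finite_profile_of_mem_omegaRL {L : OmegaLanguage α} (hL : L ∈ omegaRL α) :
    ∃ (K : Type) (_ : Finite K) (φ : List α → K), ∀ u u' w, φ u = φ u' →
      append u w ∈ L → append u' w ∈ L := by
  obtain ⟨n, U, V, hU, hV, rfl⟩ := hL
  choose K hK φ hφ using fun i => exists_finite_profile_omegaConcat (hU i) (hV i)
  refine ⟨∀ i, K i, inferInstance, fun u i => φ i u, fun u u' w h hw => ?_⟩
  obtain ⟨i, hi⟩ := Set.mem_iUnion.1 hw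
  exact Set.mem_iUnion.2 ⟨i, hφ i u u' w (congrFun h i) hi⟩

/-- Among the powers of a word, two different ones have the same continuations into an `ω`-regular
language. -/
lemma exists_lt_replicate_of_mem_omegaRL {L : OmegaLanguage α} (hL : L ∈ omegaRL α) (a : α) :
    ∃ m n : ℕ, m < n ∧ ∀ w, append (List.replicate m a) w ∈ L ↔
      append (List.replicate n a) w ∈ L := by
  obtain ⟨K, _, φ, hφ⟩ := exists_finite_profile_of_mem_omegaRL hL
  obtain ⟨m, n, hne, h⟩ := Finite.exists_ne_map_eq_of_infinite fun n => φ (List.replicate n a)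
  rcases lt_or_gt_of_ne hne with hlt | hlt
  · exact ⟨m, n, hlt, fun w => ⟨hφ _ _ w h, hφ _ _ w h.symm⟩⟩
  · exact ⟨n, m, hlt, fun w => ⟨hφ _ _ w h.symm, hφ _ _ w h⟩⟩

end Omega

/-! ### Derivation trees and interchange of subtrees -/

namespace ContextFreeGrammar

variable {T : Type} {g : ContextFreeGrammar T}

/-- `g.Yields s w` means that the terminal word `w` is the yield of a forest of derivation trees of
`g` whose roots form the string `s`. -/
inductive Yields (g : ContextFreeGrammar T) : List (Symbol T g.NT) → List T → Prop
  | nil : Yields g [] []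
  | terminal (a : T) {s w} (h : Yields g s w) : Yields g (.terminal a :: s) (a :: w)
  | rule {r} (hr : r ∈ g.rules) {s u w} (hu : Yields g r.output u) (h : Yields g s w) :
      Yields g (.nonterminal r.input :: s) (u ++ w)

lemma Yields.derives {s : List (Symbol T g.NT)} {w : List T} (h : g.Yields s w) :
    g.Derives s (w.map Symbol.terminal) := by
  induction h with
  | nil => exact .refl _
  | terminal a _ ih => exact ih.append_left [_]
  | @rule r hr s u w _ _ ihu ih =>
    have h₁ : g.Derives (.nonterminal r.input :: s) (r.output ++ s) :=
      Produces.single ⟨r, hr, .head s⟩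
    rw [List.map_append]
    exact h₁.trans ((ihu.append_right s).trans (ih.append_left _))

lemma Yields.append {s t : List (Symbol T g.NT)} {u v : List T} (hs : g.Yields s u)
    (ht : g.Yields t v) : g.Yields (s ++ t) (u ++ v) := by
  induction hs with
  | nil => exact ht
  | terminal a _ ih => exact .terminal a ih
  | rule hr hu _ _ ih =>
    rw [List.append_assoc]
    exact .rule hr hu ih

lemma Yields.exists_append {s t : List (Symbol T g.NT)} {w : List T} (h : g.Yields (s ++ t) w) :
    ∃ u v, w = u ++ v ∧ g.Yields s u ∧ g.Yields t v := by
  induction s generalizing w with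
  | nil => exact ⟨[], w, rfl, .nil, h⟩
  | cons x s ih =>
    rw [List.cons_append] at h
    cases h with
    | terminal a h =>
      obtain ⟨u, v, rfl, hu, hv⟩ := ih h
      exact ⟨a :: u, v, rfl, .terminal a hu, hv⟩
    | @rule r hr _ u' _ hu' h =>
      obtain ⟨u, v, rfl, hu, hv⟩ := ih h
      exact ⟨u' ++ u, v, by simp, .rule hr hu' hu, hv⟩

lemma yields_map_terminal (w : List T) : g.Yields (w.map Symbol.terminal) w := by
  induction w with
  | nil => exact .nil
  | cons a w ih => exact .terminal a ih

/-- Going backwards through the derivation, each rewriting step gathers the trees over the output of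
its rule under a new root. Trees, unlike derivation sequences, can be cut at a node. -/
lemma Derives.yields {s : List (Symbol T g.NT)} {w : List T}
    (h : g.Derives s (w.map Symbol.terminal)) : g.Yields s w := by
  induction h using Relation.ReflTransGen.head_induction_on with
  | refl => exact yields_map_terminal w
  | head h _ ih =>
    obtain ⟨r, hr, hrw⟩ := h
    obtain ⟨p, q, rfl, rfl⟩ := hrw.exists_parts
    obtain ⟨x, v, rfl, hx, hv⟩ := ih.exists_append
    obtain ⟨u, y, rfl, hu, hy⟩ := hx.exists_append
    have := (hu.append (Yields.rule hr hy .nil)).append hv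
    simpa using this

lemma mem_language_iff_yields {w : List T} :
    w ∈ g.language ↔ g.Yields [.nonterminal g.initial] w :=
  ⟨Derives.yields, Yields.derives⟩

/-- A derivation tree whose yield has more than `ℓ` letters `b` has a subtree whose yield has more
than `ℓ`, but not much more, letters `b`; replacing it by a subtree that belongs to the same rule
gives a derivation tree again. -/
lemma Yields.exists_subtree [BEq T] {C : ℕ} (hC : ∀ r ∈ g.rules, r.output.length ≤ C)
    (b : T) {ℓ : ℕ} (hℓ : 1 ≤ ℓ) {s : List (Symbol T g.NT)} {w : List T} (h : g.Yields s w) :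
    w.count b ≤ s.length * ℓ ∨ ∃ r ∈ g.rules, ∃ p x t, w = p ++ x ++ t ∧ g.Yields r.output x ∧
      (∀ y, g.Yields r.output y → g.Yields s (p ++ y ++ t)) ∧
      ℓ < x.count b ∧ x.count b ≤ C * ℓ := by
  induction h with
  | nil => exact .inl (by simp)
  | @terminal a s w _ ih =>
    rcases ih with ih | ⟨r, hr, p, x, t, rfl, hx, hy, h⟩
    · left
      have : (a :: w).count b ≤ w.count b + 1 := by
        rw [List.count_cons]
        split_ifs <;> omega
      rw [List.length_cons, Nat.succ_mul]
      omega
    · exact .inr ⟨r, hr, a :: p, x, t, by simp, hx, fun y h => .terminal a (hy y h), h⟩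
  | @rule r hr s u w hu hw ihu ih =>
    rcases ih with ih | ⟨r', hr', p, x, t, rfl, hx, hy, h⟩
    · rcases ihu with ihu | ⟨r', hr', p, x, t, rfl, hx, hy, h⟩
      -- Here `ihu` already bounds `u` by `|r.output| * ℓ`; if `u` also has more than `ℓ` letters
      -- `b`, it is the required subtree.
      · rcases le_or_gt (u.count b) ℓ with hle | hlt
        · left
          rw [List.length_cons, Nat.succ_mul, List.count_append]
          omega
        · exact .inr ⟨r, hr, [], u, w, by simp, hu, fun y h => .rule hr h hw, hlt,
            ihu.trans (Nat.mul_le_mul_right _ (hC r hr))⟩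
      · refine .inr ⟨r', hr', p, x, t ++ w, by simp, hx, fun y h => ?_, h⟩
        rw [← List.append_assoc]
        exact .rule hr (hy y h) hw
    · refine .inr ⟨r', hr', u ++ p, x, t, by simp, hx, fun y h => ?_, h⟩
      have := Yields.rule hr hu (hy y h)
      simpa using this

end ContextFreeGrammar

/-- Interchange lemma for context-free languages: the words of the language have subwords of
prescribed size, which come in finitely many kinds and can be interchanged with the other subwords
of their kind. -/
lemma Language.IsContextFree.exists_interchange {α : Type} [BEq α] {V : Language α}
    (hV : V.IsContextFree) : ∃ (K : Type) (_ : Finite K) (R : K → Set (List α)) (C : ℕ),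
      ∀ (b : α) (ℓ : ℕ), 1 ≤ ℓ → ∀ v ∈ V, ℓ < v.count b → ∃ κ p x t, v = p ++ x ++ t ∧ x ∈ R κ ∧
        (∀ y ∈ R κ, p ++ y ++ t ∈ V) ∧ ℓ < x.count b ∧ x.count b ≤ C * ℓ := by
  obtain ⟨g, rfl⟩ := hV
  refine ⟨g.rules, inferInstance, fun r => {x | g.Yields r.1.output x},
    g.rules.sup fun r => r.output.length, fun b ℓ hℓ v hv hlt => ?_⟩
  rw [ContextFreeGrammar.mem_language_iff_yields] at hv
  rcases hv.exists_subtree (C := g.rules.sup fun r => r.output.length)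
    (fun r hr => Finset.le_sup (f := fun r => r.output.length) hr) b hℓ with
    h | ⟨r, hr, p, x, t, rfl, hx, hy, h⟩
  -- The root string has length one, so the first alternative would bound the count by `ℓ`.
  · simp at h
    omega
  · exact ⟨⟨r, hr⟩, p, x, t, rfl, hx,
      fun y h => ContextFreeGrammar.mem_language_iff_yields.2 (hy y h), h⟩

/-! ### Interchange in `ω`-context-free languages -/

section Omega

variable {α : Type}

/-- `Interchangeable R L C b ℓ w` says that the infinite word `w` has a factor `x` in one of the
classes `R κ`, of size between `ℓ` and `C * ℓ`, which can be replaced by any other member of the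
class without leaving `L`. Sizes are measured by the number of letters `b`. -/
def Interchangeable [BEq α] {K : Type} (R : K → Set (List α)) (L : OmegaLanguage α)
    (C : ℕ) (b : α) (ℓ : ℕ) (w : OmegaWord α) : Prop :=
  ∃ κ p x w', w = append p (append x w') ∧ x ∈ R κ ∧ (∀ y ∈ R κ, append p (append y w') ∈ L) ∧
    ℓ < x.count b ∧ x.count b ≤ C * ℓ

lemma Interchangeable.imp [BEq α] {K K' : Type} {R : K → Set (List α)}
    {R' : K' → Set (List α)} {L L' : OmegaLanguage α} {C C' : ℕ} {b : α} {ℓ : ℕ} {w : OmegaWord α}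
    (h : Interchangeable R L C b ℓ w) (f : K → K') (hf : ∀ κ, R' (f κ) = R κ) (hC : C ≤ C')
    (q : List α) (hL : ∀ x, x ∈ L → append q x ∈ L') :
    Interchangeable R' L' C' b ℓ (append q w) := by
  obtain ⟨κ, p, x, w', rfl, hx, hy, h₁, h₂⟩ := h
  refine ⟨f κ, q ++ p, x, w', (append_append _ _ _).symm, by rwa [hf], fun y h => ?_, h₁,
    h₂.trans (Nat.mul_le_mul_right _ hC)⟩
  rw [append_append]
  rw [hf] at h
  exact hL _ (hy y h)

/-- Words of `V` are collected from the left until more than `ℓ` letters `b` are seen. Either a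
single word exceeds `ℓ` and contains an interchangeable factor, or each is small and their
concatenation, a member of `V*`, overshoots to at most `2 * ℓ`. -/
lemma exists_interchange_omegaPower [BEq α] {V : Language α} (hV : V.IsContextFree) :
    ∃ (K : Type) (_ : Finite K) (R : K → Set (List α)) (C : ℕ), ∀ (b : α) (ℓ : ℕ), 1 ≤ ℓ →
      ∀ w ∈ omegaPower V, ∀ m, ℓ < (w.factor 0 m).count b →
        Interchangeable R (omegaPower V) C b ℓ w := by
  obtain ⟨K, _, R, C, hR⟩ := hV.exists_interchange
  -- The extra class `none` is `V*` itself; it is the reason for the constant `2`.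
  refine ⟨Option K, inferInstance, fun o => o.elim (KStar.kstar V : Language α) R, max C 2, ?_⟩
  intro b ℓ hℓ
  have key : ∀ n m, m ≤ n → ∀ s ∈ KStar.kstar V, ∀ w ∈ omegaPower V, s.count b ≤ ℓ →
      ℓ < s.count b + (w.factor 0 m).count b →
      Interchangeable (fun o : Option K => o.elim (KStar.kstar V : Language α) R) (omegaPower V)
        (max C 2) b ℓ (append s w) := by
    intro n
    induction n with
    | zero =>
      intro m hm s _ w _ hs hlt
      obtain rfl : m = 0 := by omega
      simp [factor] at hlt
      omega
    | succ n ih =>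
      intro m hm s hs w hw hsℓ hlt
      obtain ⟨v, hv, hne, w', hw', rfl⟩ := exists_of_mem_omegaPower hw
      have hpos := List.length_pos_iff.2 hne
      rcases lt_or_ge ℓ (v.count b) with hvℓ | hvℓ
      · obtain ⟨κ, p, x, t, rfl, hx, hy, h₁, h₂⟩ := hR b ℓ hℓ v hv hvℓ
        refine ⟨some κ, s ++ p, x, append t w', by simp [append_append], hx, fun y h => ?_, h₁,
          h₂.trans (Nat.mul_le_mul_right _ (le_max_left _ _))⟩
        have := append_mem_omegaPower_of_mem_kstar hs (append_mem_omegaPower (hy y h) hw')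
        simpa [append_append] using this
      have hsv : s ++ v ∈ KStar.kstar V := append_mem_kstar hs (mem_kstar_self hv)
      rcases lt_or_ge ℓ ((s ++ v).count b) with hsvℓ | hsvℓ
      · refine ⟨none, [], s ++ v, w', by simp [append_append], hsv,
          fun y h => append_mem_omegaPower_of_mem_kstar (v := y) h hw', hsvℓ, ?_⟩
        have : 2 * ℓ ≤ max C 2 * ℓ := Nat.mul_le_mul_right _ (le_max_right _ _)
        rw [List.count_append]
        omega
      · rw [← append_append]
        refine ih (m - v.length) (by omega) (s ++ v) hsv w' hw' hsvℓ (hlt.trans_le ?_)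
        rw [List.count_append, add_assoc]
        refine Nat.add_le_add_left ?_ _
        rcases le_total v.length m with hm' | hm'
        · rw [← factor_append_factor _ (Nat.zero_le _) hm', factor_append, List.count_append]
          have := factor_append_add v w' 0 (m - v.length)
          rw [add_zero, Nat.add_sub_cancel' hm'] at this
          rw [this]
        · have := factor_append_factor (append v w') (Nat.zero_le m) hm'
          rw [factor_append] at this
          conv_rhs => rw [← this, List.count_append]
          omega
  intro w hw m hlt
  exact key m m le_rfl [] (Language.nil_mem_kstar V) w hw (by simp) (by simpa using hlt)

/-- The bound is `2 * ℓ` because it leaves more than `ℓ` letters `b` either to the word from `U` or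
to the part of the prefix that lies in `V^ω`. -/
lemma exists_interchange_omegaConcat [BEq α] {U V : Language α} (hU : U.IsContextFree)
    (hV : V.IsContextFree) :
    ∃ (K : Type) (_ : Finite K) (R : K → Set (List α)) (C : ℕ), ∀ (b : α) (ℓ : ℕ), 1 ≤ ℓ →
      ∀ w ∈ omegaConcat U (omegaPower V), ∀ m, 2 * ℓ < (w.factor 0 m).count b →
        Interchangeable R (omegaConcat U (omegaPower V)) C b ℓ w := by
  obtain ⟨K₁, _, R₁, C₁, h₁⟩ := hU.exists_interchange
  obtain ⟨K₂, _, R₂, C₂, h₂⟩ := exists_interchange_omegaPower hV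
  refine ⟨K₁ ⊕ K₂, inferInstance, Sum.elim R₁ R₂, max C₁ C₂, fun b ℓ hℓ w hw m hm => ?_⟩
  obtain ⟨u, hu, x, hx, rfl⟩ := mem_omegaConcat.1 hw
  rcases lt_or_ge ℓ (u.count b) with hlt | hle
  · obtain ⟨κ, p, y, t, rfl, hy, hz, hlo, hhi⟩ := h₁ b ℓ hℓ u hu hlt
    refine ⟨.inl κ, p, y, append t x, by simp [append_append], hy, fun z h => ?_, hlo,
      hhi.trans (Nat.mul_le_mul_right _ (le_max_left _ _))⟩
    exact mem_omegaConcat.2 ⟨_, hz z h, x, hx, by simp [append_append]⟩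
  · refine (h₂ b ℓ hℓ x hx (m - u.length) ?_).imp .inr (fun _ => rfl) (le_max_right _ _) u
      fun y hy => mem_omegaConcat.2 ⟨u, hu, y, hy, rfl⟩
    rcases le_total u.length m with hm' | hm'
    · rw [← factor_append_factor _ (Nat.zero_le _) hm', factor_append, List.count_append] at hm
      have := factor_append_add u x 0 (m - u.length)
      rw [add_zero, Nat.add_sub_cancel' hm'] at this
      rw [this] at hm
      omega
    · have := factor_append_factor (append u x) (Nat.zero_le m) hm'
      rw [factor_append] at this
      rw [← this, List.count_append] at hle
      omega

/-- Interchange lemma for `ω`-context-free languages. -/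
lemma exists_interchange_of_mem_omegaCFL [BEq α] {L : OmegaLanguage α}
    (hL : L ∈ omegaCFL α) :
    ∃ (K : Type) (_ : Finite K) (R : K → Set (List α)) (C : ℕ), ∀ (b : α) (ℓ : ℕ), 1 ≤ ℓ →
      ∀ w ∈ L, ∀ m, 2 * ℓ < (w.factor 0 m).count b → Interchangeable R L C b ℓ w := by
  obtain ⟨n, U, V, hU, hV, rfl⟩ := hL
  choose K hK R C h using fun i => exists_interchange_omegaConcat (hU i) (hV i)
  refine ⟨Σ i, K i, inferInstance, fun κ => R κ.1 κ.2, Finset.univ.sup C,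
    fun b ℓ hℓ w hw m hm => ?_⟩
  obtain ⟨i, hi⟩ := Set.mem_iUnion.1 hw
  exact (h i b ℓ hℓ w hi m hm).imp (fun κ => ⟨i, κ⟩) (fun _ => rfl)
    (Finset.le_sup (Finset.mem_univ i)) [] fun x hx => Set.mem_iUnion.2 ⟨i, hx⟩

end Omega

lemma OmegaWord.append_replicate_apply {α : Type} (k : ℕ) (a : α) (w : OmegaWord α) (i : ℕ) :
    append (List.replicate k a) w i = if i < k then a else w (i - k) := by
  split_ifs with h
  · rw [append_apply_lt _ _ (by simpa using h), List.getElem_replicate]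
  · obtain ⟨j, rfl⟩ := Nat.exists_eq_add_of_le (not_lt.1 h)
    have := append_apply_add (List.replicate k a) w j
    rw [List.length_replicate] at this
    rw [this, Nat.add_sub_cancel_left]

lemma forall_of_mem_omegaPower {α : Type} {V : Language α} {P : α → Prop}
    (hV : ∀ v ∈ V, ∀ x ∈ v, P x) {w : OmegaWord α} (hw : w ∈ omegaPower V) (i : ℕ) : P (w i) := by
  induction i using Nat.strong_induction_on generalizing w with
  | _ i ih =>
    obtain ⟨v, hv, hne, w', hw', rfl⟩ := exists_of_mem_omegaPower hw
    rcases lt_or_ge i v.length with h | h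
    · rw [append_apply_lt _ _ h]
      exact hV v hv _ (List.getElem_mem h)
    · obtain ⟨j, rfl⟩ := Nat.exists_eq_add_of_le h
      have hpos := List.length_pos_iff.2 hne
      rw [append_apply_add]
      exact ih j (by omega) hw'

lemma const_mem_omegaPower {α : Type} {V : Language α} {a : α} (h : [a] ∈ V) :
    (fun _ => a) ∈ omegaPower V := by
  refine ⟨id, strictMono_id, rfl, fun i => ?_⟩
  simpa [factor] using h

/-! ### Recurrence of unitary runs -/

namespace QuantumAutomaton

variable {α H : Type} [NormedAddCommGroup H] [InnerProductSpace ℂ H] (A : QuantumAutomaton α H)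

lemma norm_run (w : OmegaWord α) (n : ℕ) : ‖A.run w n‖ = 1 := by
  induction n with
  | zero => exact A.norm_init
  | succ n ih => rw [run, LinearIsometryEquiv.norm_map, ih]

lemma run_congr {w w' : OmegaWord α} {n : ℕ} (h : ∀ i < n, w i = w' i) :
    A.run w n = A.run w' n := by
  induction n with
  | zero => rfl
  | succ n ih => rw [run, run, h n n.lt_succ_self, ih fun i hi => h i (hi.trans n.lt_succ_self)]

/-- Both runs read the same letters, and unitaries preserve distances. -/
lemma norm_run_add_sub_run {w w' : OmegaWord α} {m : ℕ} (h : ∀ i, w (m + i) = w' i) (n : ℕ) :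
    ‖A.run w (m + n) - A.run w' n‖ = ‖A.run w m - A.init‖ := by
  induction n with
  | zero => rfl
  | succ n ih => rw [← add_assoc, run, run, h, ← map_sub, LinearIsometryEquiv.norm_map, ih]

/-- By compactness of the sphere two states of the run are close; as the letter is constant, undoing
the common isometry moves the earlier one back to the initial state. -/
lemma exists_norm_run_const_sub_lt [FiniteDimensional ℂ H] (b : α) {ε : ℝ} (hε : 0 < ε) :
    ∃ k, 0 < k ∧ ‖A.run (fun _ => b) k - A.init‖ < ε := by
  have : ProperSpace H := FiniteDimensional.proper ℂ H
  obtain ⟨x, -, φ, hφ, hx⟩ := (isCompact_sphere (0 : H) 1).tendsto_subseq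
    (x := A.run fun _ => b) fun n => by simp [norm_run]
  obtain ⟨N, hN⟩ := Metric.cauchySeq_iff.1 hx.cauchySeq ε hε
  have hlt := hφ (Nat.lt_succ_self N)
  refine ⟨φ (N + 1) - φ N, by simp only [Nat.succ_eq_add_one] at hlt; omega, ?_⟩
  have h := A.norm_run_add_sub_run (w := fun _ => b) (w' := fun _ => b)
    (m := φ (N + 1) - φ N) (fun _ => rfl) (φ N)
  rw [← h, Nat.sub_add_cancel hlt.le, ← dist_eq_norm]
  exact hN _ (Nat.le_succ N) _ le_rfl

lemma norm_inner_sq_le_one {ψ x : H} (hψ : ‖ψ‖ = 1) (hx : ‖x‖ = 1) : ‖⟪ψ, x⟫‖ ^ 2 ≤ 1 := by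
  have := norm_inner_le_norm (𝕜 := ℂ) ψ x
  rw [hψ, hx, one_mul] at this
  exact pow_le_one₀ (norm_nonneg _) this

lemma bddBelow_range_norm_inner_sq (ψ : H) (x : ℕ → H) :
    BddBelow (Set.range fun i => ‖⟪ψ, x i⟫‖ ^ 2) :=
  ⟨0, by rintro _ ⟨i, rfl⟩; positivity⟩

lemma iInf_norm_inner_run_le (w : OmegaWord α) {ψ : H} (hψ : ‖ψ‖ = 1) (n : ℕ → ℕ) :
    ⨅ i, ‖⟪ψ, A.run w (n i)⟫‖ ^ 2 ≤ 1 :=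
  (ciInf_le (bddBelow_range_norm_inner_sq ψ fun i => A.run w (n i)) 0).trans
    (norm_inner_sq_le_one hψ (A.norm_run w _))

lemma nonempty_strictMono : Nonempty {n : ℕ → ℕ // StrictMono n} := ⟨⟨id, strictMono_id⟩⟩

lemma le_acceptND {w : OmegaWord α} {ψ : H} (hF : ψ ∈ A.F) (hψ : ‖ψ‖ = 1) {n : ℕ → ℕ}
    (hn : StrictMono n) {r : ℝ} (hr : ∀ i, r ≤ ‖⟪ψ, A.run w (n i)⟫‖ ^ 2) : r ≤ A.acceptND w := by
  have := nonempty_strictMono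
  refine (le_ciInf hr).trans (le_ciSup_of_le ?_ ⟨ψ, hF, hψ⟩ (le_ciSup_of_le ?_ ⟨n, hn⟩ le_rfl))
  · refine ⟨1, ?_⟩
    rintro _ ⟨ψ, rfl⟩
    exact ciSup_le fun n => A.iInf_norm_inner_run_le w ψ.2.2 n
  · refine ⟨1, ?_⟩
    rintro _ ⟨m, rfl⟩
    exact A.iInf_norm_inner_run_le w hψ m

lemma exists_of_lt_acceptND {w : OmegaWord α} {c : ℝ} (hc : 0 ≤ c) (h : c < A.acceptND w) :
    ∃ ψ ∈ A.F, ‖ψ‖ = 1 ∧ ∃ n : ℕ → ℕ, StrictMono n ∧ ∃ r, c < r ∧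
      ∀ i, r ≤ ‖⟪ψ, A.run w (n i)⟫‖ ^ 2 := by
  have := nonempty_strictMono
  rw [acceptND] at h
  cases isEmpty_or_nonempty {ψ : H // ψ ∈ A.F ∧ ‖ψ‖ = 1} with
  | inl he =>
    -- If `F = 0`, the supremum has the default value `0`, which is not above `c`.
    rw [Real.iSup_of_isEmpty] at h
    exact absurd h hc.not_gt
  | inr _ =>
    obtain ⟨ψ, hψ⟩ := exists_lt_of_lt_ciSup h
    obtain ⟨n, hn⟩ := exists_lt_of_lt_ciSup hψ
    exact ⟨ψ, ψ.2.1, ψ.2.2, n, n.2, _, hn, fun i =>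
      ciInf_le (bddBelow_range_norm_inner_sq (ψ : H) fun i => A.run w ((n : ℕ → ℕ) i)) i⟩

lemma norm_inner_sq_le_add {ψ x y : H} (hψ : ‖ψ‖ = 1) (hx : ‖x‖ = 1) (hy : ‖y‖ = 1) :
    ‖⟪ψ, x⟫‖ ^ 2 ≤ ‖⟪ψ, y⟫‖ ^ 2 + 2 * ‖y - x‖ := by
  have h₁ := norm_inner_le_norm (𝕜 := ℂ) ψ x
  have h₂ := norm_inner_le_norm (𝕜 := ℂ) ψ y
  have h₃ := norm_inner_le_norm (𝕜 := ℂ) ψ (y - x)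
  have h₄ : ‖⟪ψ, x⟫‖ - ‖⟪ψ, y⟫‖ ≤ ‖⟪ψ, y - x⟫‖ := by
    rw [inner_sub_right, norm_sub_rev]
    exact norm_sub_norm_le _ _
  rw [hψ, one_mul] at h₁ h₂ h₃
  rw [hx] at h₁
  rw [hy] at h₂
  have h₅ := norm_nonneg (⟪ψ, x⟫)
  have h₆ := norm_nonneg (⟪ψ, y⟫)
  have h₇ := norm_nonneg (y - x)
  nlinarith

/-- Acceptance with a probability above a threshold is not destroyed by a suitable block of equal
letters read at the beginning. -/
lemma exists_lt_acceptND_append_replicate [FiniteDimensional ℂ H] {w : OmegaWord α} {c : ℝ}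
    (hc : 0 ≤ c) (h : c < A.acceptND w) (b : α) :
    ∃ k, 0 < k ∧ c < A.acceptND (append (List.replicate k b) w) := by
  obtain ⟨ψ, hF, hψ, n, hn, r, hr, hi⟩ := A.exists_of_lt_acceptND hc h
  -- A displacement below `(r - c) / 4` costs at most `(r - c) / 2` in probability, which leaves `(r
  -- + c) / 2 > c` at the checkpoints shifted by `k`.
  obtain ⟨k, hk, hlt⟩ := A.exists_norm_run_const_sub_lt b (ε := (r - c) / 4) (by linarith)
  refine ⟨k, hk, (by linarith : c < (r + c) / 2).trans_le
    (A.le_acceptND hF hψ (n := fun i => k + n i) (fun i j hij => Nat.add_lt_add_left (hn hij) k)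
      fun i => ?_)⟩
  have h₁ := A.norm_run_add_sub_run (w := append (List.replicate k b) w) (w' := w) (m := k)
    (fun i => by simp [append_replicate_apply]) (n i)
  have h₂ : A.run (append (List.replicate k b) w) k = A.run (fun _ => b) k :=
    A.run_congr fun i hi => by simp [append_replicate_apply, hi]
  have h₃ := norm_inner_sq_le_add hψ (A.norm_run w (n i))
    (A.norm_run (append (List.replicate k b) w) (k + n i))
  rw [h₁, h₂] at h₃
  have := hi i
  linarith

end QuantumAutomaton

/-- A language that loses one of its words when letters `b` are put in front of it is not a strict
threshold language. -/
lemma notMem_strictThresholdClassND {α : Type} {L : OmegaLanguage α} {w : OmegaWord α} (hw : w ∈ L)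
    (b : α) (h : ∀ k, 0 < k → append (List.replicate k b) w ∉ L) {c : ℝ} (hc : 0 ≤ c) :
    L ∉ strictThresholdClassND α c := by
  rintro ⟨H, _, _, _, A, rfl⟩
  obtain ⟨k, hk, hlt⟩ := A.exists_lt_acceptND_append_replicate hc hw b
  exact h k hk hlt

/-! ### Languages outside all strict threshold classes -/

section Examples

/-- The words without the letter `true`. -/
def falseWords : Language Bool := {v | ∀ x ∈ v, x = false}

lemma isRegular_falseWords : falseWords.IsRegular := by
  refine Language.isRegular_iff.2 ⟨Bool, inferInstance, ⟨fun s x => s || x, false, {false}⟩, ?_⟩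
  have key : ∀ (v : List Bool) (s : Bool), DFA.evalFrom
      (⟨fun s x => s || x, false, {false}⟩ : DFA Bool Bool) s v = false ↔
      s = false ∧ ∀ x ∈ v, x = false := by
    intro v
    induction v with
    | nil => simp
    | cons a v ih =>
      intro s
      rw [DFA.evalFrom_cons, ih]
      simp [and_assoc]
  ext v
  exact (key v false).trans (by rw [eq_self_iff_true, true_and]; rfl)

lemma exists_omegaRL_notMem_strictThresholdClassND :
    ∃ L ∈ omegaRL Bool, ∀ c ∈ Set.Ico (0 : ℝ) 1, L ∉ strictThresholdClassND Bool c := by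
  refine ⟨omegaConcat falseWords (omegaPower falseWords),
    ⟨1, fun _ => falseWords, fun _ => falseWords, fun _ => isRegular_falseWords,
      fun _ => isRegular_falseWords, (Set.iUnion_const _).symm⟩, fun c hc => ?_⟩
  refine notMem_strictThresholdClassND (w := fun _ => false) ?_ true ?_ hc.1
  · exact mem_omegaConcat.2 ⟨[], fun x hx => by simp at hx, _,
      const_mem_omegaPower (fun x hx => by simpa using hx), rfl⟩
  · intro k hk h
    obtain ⟨u, hu, x, hx, he⟩ := mem_omegaConcat.1 h
    have := forall_of_mem_omegaPower (P := fun x => x = false) (fun v hv => hv)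
      (append_mem_omegaPower hu hx) 0
    rw [he, append_replicate_apply, if_pos hk] at this
    cases this

/-- The language of the words `aⁿbⁿ`, where `a` is `false` and `b` is `true`. -/
def balancedBlocks : Language Bool :=
  {v | ∃ n, v = List.replicate n false ++ List.replicate n true}

/-- The grammar `S → aSb | ε` of `balancedBlocks`. -/
def balancedBlocksGrammar : ContextFreeGrammar Bool where
  NT := Unit
  initial := ()
  rules := {⟨(), [.terminal false, .nonterminal (), .terminal true]⟩, ⟨(), []⟩}

lemma mem_rules_balancedBlocksGrammar {r : ContextFreeRule Bool Unit} :
    r ∈ balancedBlocksGrammar.rules ↔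
      r = ⟨(), [.terminal false, .nonterminal (), .terminal true]⟩ ∨ r = ⟨(), []⟩ := by
  change r ∈ ({_, _} : Finset (ContextFreeRule Bool Unit)) ↔ _
  rw [Finset.mem_insert, Finset.mem_singleton]

lemma isContextFree_balancedBlocks : balancedBlocks.IsContextFree := by
  refine ⟨balancedBlocksGrammar, Set.ext fun v => ?_⟩
  refine ContextFreeGrammar.mem_language_iff_yields.trans ⟨fun h => ?_, ?_⟩
  · change balancedBlocksGrammar.Yields [.nonterminal ()] v at h
    induction hn : v.length using Nat.strong_induction_on generalizing v with
    | _ n ih =>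
      cases h with
      | @rule r hr _ u w hu hw =>
        cases hw
        rcases mem_rules_balancedBlocksGrammar.1 hr with rfl | rfl
        · cases hu with
          | @terminal _ _ u hu =>
            obtain ⟨x, y, rfl, hx, hy⟩ := ContextFreeGrammar.Yields.exists_append
              (g := balancedBlocksGrammar) (s := [.nonterminal ()]) (t := [.terminal true]) hu
            cases hy with
            | @terminal _ _ y hy =>
              cases hy
              obtain ⟨m, rfl⟩ := ih x.length (by rw [← hn]; simp) _ hx rfl
              refine ⟨m + 1, ?_⟩
              rw [List.replicate_succ, List.replicate_succ']
              simp
        · cases hu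
          exact ⟨0, rfl⟩
  · rintro ⟨n, rfl⟩
    change balancedBlocksGrammar.Yields [.nonterminal ()] _
    induction n with
    | zero =>
      exact .rule (g := balancedBlocksGrammar) (r := ⟨(), []⟩)
        (mem_rules_balancedBlocksGrammar.2 (.inr rfl)) .nil .nil
    | succ n ih =>
      have := ContextFreeGrammar.Yields.rule (g := balancedBlocksGrammar)
        (r := ⟨(), [.terminal false, .nonterminal (), .terminal true]⟩)
        (mem_rules_balancedBlocksGrammar.2 (.inl rfl)) (.terminal false (ih.append (.terminal true .nil))) .nil
      rw [List.replicate_succ, List.replicate_succ']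
      simpa using this

lemma isContextFree_singleton {α : Type} (a : α) : ({[a]} : Language α).IsContextFree := by
  refine ⟨⟨Unit, (), {⟨(), [.terminal a]⟩}⟩, Set.ext fun v => ?_⟩
  refine ContextFreeGrammar.mem_language_iff_yields.trans ⟨fun h => ?_, ?_⟩
  · cases h with
    | @rule r hr _ u w hu hw =>
      cases hw
      obtain rfl : r = ⟨(), [.terminal a]⟩ := by simpa using hr
      cases hu with
      | terminal _ hu => cases hu; rfl
  · rintro rfl
    exact .rule (g := ⟨Unit, (), {⟨(), [.terminal a]⟩}⟩) (r := ⟨(), [.terminal a]⟩)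
      (by simp) (.terminal a .nil) .nil

/-- The language of the infinite words `aⁿbⁿaaa…`, where `a` is `false` and `b` is `true`. -/
def balancedBlocksOmega : OmegaLanguage Bool :=
  omegaConcat balancedBlocks (omegaPower {[false]})

lemma append_replicate_mem_balancedBlocksOmega (n : ℕ) :
    append (List.replicate n false) (append (List.replicate n true) fun _ => false) ∈
      balancedBlocksOmega :=
  mem_omegaConcat.2 ⟨_, ⟨n, rfl⟩, _, const_mem_omegaPower rfl, append_append _ _ _⟩

lemma exists_of_mem_balancedBlocksOmega {w : OmegaWord Bool} (hw : w ∈ balancedBlocksOmega) :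
    ∃ n, ∀ i, w i = true ↔ n ≤ i ∧ i < 2 * n := by
  obtain ⟨_, ⟨n, rfl⟩, x, hx, rfl⟩ := mem_omegaConcat.1 hw
  have hx' : ∀ i, x i = false := forall_of_mem_omegaPower (P := fun x => x = false)
    (by rintro _ rfl; simp) hx
  refine ⟨n, fun i => ?_⟩
  rw [append_append, append_replicate_apply]
  split_ifs with h₁
  · simp; omega
  · rw [append_replicate_apply]
    split_ifs with h₂
    · simp; omega
    · simp [hx']; omega

lemma balancedBlocksOmega_notMem_omegaRL : balancedBlocksOmega ∉ omegaRL Bool := by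
  intro h
  obtain ⟨m, n, hlt, hmn⟩ := exists_lt_replicate_of_mem_omegaRL h false
  obtain ⟨j, hj⟩ := exists_of_mem_balancedBlocksOmega
    ((hmn _).2 (append_replicate_mem_balancedBlocksOmega n))
  simp only [append_replicate_apply] at hj
  -- The first and the last `b` of `aᵐbⁿaaa…` give `j ≤ m` and `m + n ≤ 2 * j`, against `m < n`.
  have h₁ := (hj m).1 (by rw [if_neg (by omega), if_pos (by omega)])
  have h₂ := (hj (m + n - 1)).1 (by rw [if_neg (by omega), if_pos (by omega)])
  omega

lemma exists_omegaCFL_notMem_strictThresholdClassND :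
    ∃ L ∈ omegaCFL Bool \ omegaRL Bool, ∀ c ∈ Set.Ico (0 : ℝ) 1,
      L ∉ strictThresholdClassND Bool c := by
  refine ⟨balancedBlocksOmega, ⟨⟨1, fun _ => balancedBlocks, fun _ => {[false]},
    fun _ => isContextFree_balancedBlocks, fun _ => isContextFree_singleton false,
    (Set.iUnion_const _).symm⟩, balancedBlocksOmega_notMem_omegaRL⟩, fun c hc => ?_⟩
  refine notMem_strictThresholdClassND (append_replicate_mem_balancedBlocksOmega 0) true ?_ hc.1
  intro k hk h
  obtain ⟨j, hj⟩ := exists_of_mem_balancedBlocksOmega h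
  have := (hj 0).1 (by rw [append_replicate_apply, if_pos hk])
  omega

end Examples

/-! ### Automata that count letters by phases -/

lemma OmegaWord.factor_succ {α : Type} (w : OmegaWord α) (n : ℕ) :
    w.factor 0 (n + 1) = w.factor 0 n ++ [w n] := by
  rw [← factor_append_factor w (Nat.zero_le n) n.le_succ]
  simp [factor]

namespace QuantumAutomaton

/-- If the accepting space is a line and the run becomes constant, then the acceptance probability
is the probability of a single measurement. -/
lemma acceptND_eq_of_eventually_const {α H : Type} [NormedAddCommGroup H] [InnerProductSpace ℂ H]
    (A : QuantumAutomaton α H) {w : OmegaWord α} {ψ s : H} (hψ : ‖ψ‖ = 1) (hF : A.F = ℂ ∙ ψ) {N : ℕ}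
    (hs : ∀ n, N ≤ n → A.run w n = s) : A.acceptND w = ‖⟪ψ, s⟫‖ ^ 2 := by
  apply le_antisymm
  · by_contra! hlt
    obtain ⟨φ, hφF, hφ, n, hn, r, hr, hi⟩ := A.exists_of_lt_acceptND (by positivity) hlt
    rw [hF] at hφF
    obtain ⟨a, rfl⟩ := Submodule.mem_span_singleton.1 hφF
    rw [norm_smul, hψ, mul_one] at hφ
    have := hi N
    rw [hs _ (hn.le_apply), inner_smul_left, norm_mul, RCLike.norm_conj, hφ, one_mul] at this
    linarith
  · refine A.le_acceptND (hF ▸ Submodule.mem_span_singleton_self ψ) hψ (n := fun i => N + i)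
      (fun i j h => Nat.add_lt_add_left h N) fun i => ?_
    rw [hs _ (Nat.le_add_right N i)]

end QuantumAutomaton

section Phase

variable {ι : Type} [Fintype ι] [Nonempty ι]

variable (ι) in
/-- The uniform superposition of the basis vectors. -/
noncomputable def uniformState : EuclideanSpace ℂ ι :=
  WithLp.toLp 2 fun _ => ((√(Fintype.card ι))⁻¹ : ℝ)

lemma uniformState_apply_ne_zero (i : ι) : uniformState ι i ≠ 0 := by
  simp [uniformState]

lemma norm_uniformState : ‖uniformState ι‖ = 1 := by
  have h : (0 : ℝ) < Fintype.card ι := by exact_mod_cast Fintype.card_pos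
  rw [EuclideanSpace.norm_eq, Real.sqrt_eq_one]
  simp only [uniformState, Complex.norm_real, norm_inv, Real.norm_eq_abs,
    abs_of_nonneg (Real.sqrt_nonneg _), inv_pow, Real.sq_sqrt h.le, Finset.sum_const,
    Finset.card_univ, nsmul_eq_mul]
  exact mul_inv_cancel₀ h.ne'

/-- The automaton with state space `ℂ^ι` in which the letter `some i` turns the phase of the `i`-th
basis vector by `z` and the letter `none` does nothing. -/
noncomputable def phaseAutomaton (ι : Type) [Fintype ι] [Nonempty ι] [DecidableEq ι] (z : Circle) :
    QuantumAutomaton (Option ι) (EuclideanSpace ℂ ι) where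
  init := uniformState ι
  norm_init := norm_uniformState
  U o := LinearIsometryEquiv.piLpCongrRight 2 fun i =>
    (if o = some i then (⟨z, (Unitary.mem_iff).2 ⟨by simp [← Complex.normSq_eq_conj_mul_self],
      by simp [Complex.mul_conj]⟩⟩ : unitary ℂ) else 1) • LinearIsometryEquiv.refl ℂ ℂ
  F := ℂ ∙ uniformState ι

variable [DecidableEq ι]

lemma phaseAutomaton_run_apply (z : Circle) (w : OmegaWord (Option ι)) (n : ℕ) (i : ι) :
    (phaseAutomaton ι z).run w n i =
      (z : ℂ) ^ (w.factor 0 n).count (some i) * uniformState ι i := by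
  induction n with
  | zero => simp [QuantumAutomaton.run, phaseAutomaton, factor]
  | succ n ih =>
    rw [QuantumAutomaton.run, factor_succ, List.count_append, pow_add, mul_right_comm, ← ih]
    by_cases h : w n = some i
    · simp [phaseAutomaton, h, mul_comm]
    · simp [phaseAutomaton, h]

/-- The state that is reached from the uniform one by the word `u`. -/
noncomputable def phaseState (z : Circle) (u : List (Option ι)) : EuclideanSpace ℂ ι :=
  WithLp.toLp 2 fun i => (z : ℂ) ^ u.count (some i) * uniformState ι i

lemma phaseAutomaton_run_append_none (z : Circle) (u : List (Option ι)) {n : ℕ}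
    (hn : u.length ≤ n) :
    (phaseAutomaton ι z).run (append u fun _ => none) n = phaseState z u := by
  ext i
  obtain ⟨m, rfl⟩ := Nat.exists_eq_add_of_le hn
  have h := factor_append_add u (fun _ => none) 0 m
  rw [add_zero] at h
  rw [phaseAutomaton_run_apply, ← factor_append_factor _ (Nat.zero_le _) hn, factor_append, h]
  simp [phaseState, factor, List.count_replicate]

lemma phaseAutomaton_acceptND (z : Circle) (u : List (Option ι)) :
    (phaseAutomaton ι z).acceptND (append u fun _ => none) =
      ‖⟪uniformState ι, phaseState z u⟫‖ ^ 2 :=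
  (phaseAutomaton ι z).acceptND_eq_of_eventually_const norm_uniformState rfl fun _ hn =>
    phaseAutomaton_run_append_none z u hn

lemma inner_uniformState_phaseState (z : Circle) (u : List (Option ι)) :
    ⟪uniformState ι, phaseState z u⟫ =
      (∑ i, (z : ℂ) ^ u.count (some i)) / Fintype.card ι := by
  have h : (0 : ℝ) ≤ Fintype.card ι := by positivity
  rw [PiLp.inner_apply, Finset.sum_div]
  refine Finset.sum_congr rfl fun i _ => ?_
  simp only [phaseState, uniformState, RCLike.inner_apply, Complex.conj_ofReal]
  rw [mul_assoc, ← Complex.ofReal_mul, ← mul_inv, Real.mul_self_sqrt h, div_eq_mul_inv]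
  push_cast
  ring

lemma norm_phaseState (z : Circle) (u : List (Option ι)) : ‖phaseState z u‖ = 1 := by
  rw [← phaseAutomaton_run_append_none z u le_rfl, QuantumAutomaton.norm_run]

/-- A word followed by the idle letter is accepted almost surely if and only if all the other
letters occur equally often in it. -/
lemma append_mem_almostSureLanguageND_iff {z : Circle}
    (hz : Function.Injective fun n : ℕ => (z : ℂ) ^ n) (u : List (Option ι)) :
    append u (fun _ => none) ∈ (phaseAutomaton ι z).almostSureLanguageND ↔
      ∀ i j, u.count (some i) = u.count (some j) := by
  have h₁ : uniformState ι ≠ 0 := norm_ne_zero_iff.1 (by simp [norm_uniformState])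
  have h₂ : phaseState z u ≠ 0 := norm_ne_zero_iff.1 (by simp [norm_phaseState])
  change (phaseAutomaton ι z).acceptND _ = 1 ↔ _
  rw [phaseAutomaton_acceptND, pow_eq_one_iff_of_nonneg (norm_nonneg _) two_ne_zero]
  -- Probability `1` is equality in Cauchy–Schwarz, so the final state is a multiple of the uniform
  -- one and all its phases agree.
  have h₃ := norm_inner_eq_norm_iff (𝕜 := ℂ) h₁ h₂
  rw [norm_uniformState, norm_phaseState, one_mul] at h₃
  rw [h₃]
  constructor
  · rintro ⟨r, -, hr⟩
    have key : ∀ i, (z : ℂ) ^ u.count (some i) = r := fun i => by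
      have := congrArg (fun x : EuclideanSpace ℂ ι => x i) hr
      simpa [phaseState, uniformState_apply_ne_zero] using this
    exact fun i j => hz ((key i).trans (key j).symm)
  · intro h
    obtain ⟨i₀⟩ := ‹Nonempty ι›
    refine ⟨(z : ℂ) ^ u.count (some i₀), pow_ne_zero _ z.coe_ne_zero, ?_⟩
    ext i
    simp [phaseState, h i i₀]

end Phase

/-! ### Irrational rotations -/

/-- There is a point of the circle all of whose nontrivial powers have dense orbits. -/
lemma exists_circle_denseRange_zpow :
    ∃ z : Circle, ∀ d : ℤ, d ≠ 0 → DenseRange fun k : ℤ => z ^ (d * k) := by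
  -- All nonzero integer multiples of `√2` are irrational, so one angle serves every `d`.
  refine ⟨AddCircle.toCircle ((√2 : ℝ) : AddCircle (1 : ℝ)), fun d hd => ?_⟩
  have h : DenseRange (· • ((d * √2 : ℝ) : AddCircle (1 : ℝ)) : ℤ → AddCircle (1 : ℝ)) := by
    rw [AddCircle.denseRange_zsmul_coe_iff, div_one]
    exact irrational_sqrt_two.intCast_mul hd
  have hs : Function.Surjective (AddCircle.toCircle (T := (1 : ℝ))) := by
    have := (AddCircle.homeomorphCircle (one_ne_zero (α := ℝ))).surjective
    intro x
    obtain ⟨y, hy⟩ := this x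
    exact ⟨y, by rw [← hy, AddCircle.homeomorphCircle_apply]⟩
  have := hs.denseRange.comp h AddCircle.continuous_toCircle
  refine this.mono ?_
  rintro _ ⟨k, rfl⟩
  refine ⟨k, ?_⟩
  have he : ((d * √2 : ℝ) : AddCircle (1 : ℝ)) = d • ((√2 : ℝ) : AddCircle (1 : ℝ)) := by
    rw [← AddCircle.coe_zsmul, zsmul_eq_mul]
  simp only [Function.comp_apply]
  rw [he, AddCircle.toCircle_zsmul, AddCircle.toCircle_zsmul, zpow_mul]

/-- A coincidence `z ^ m = z ^ n` would make the orbit of `z ^ (m - n)` the single point `1`, which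
misses a neighbourhood of `-1`. -/
lemma injective_pow_of_denseRange_zpow {z : Circle}
    (hz : ∀ d : ℤ, d ≠ 0 → DenseRange fun k : ℤ => z ^ (d * k)) :
    Function.Injective fun n : ℕ => (z : ℂ) ^ n := by
  intro m n h
  by_contra hne
  have h' : z ^ m = z ^ n := by
    ext
    simpa using h
  have h₁ : z ^ ((m : ℤ) - n) = 1 := by
    rw [zpow_sub, zpow_natCast, zpow_natCast, h', mul_inv_cancel]
  have hd := hz ((m : ℤ) - n) (by omega)
  simp only [zpow_mul, h₁, one_zpow] at hd
  obtain ⟨k, hk⟩ := hd.exists_mem_open (isOpen_compl_singleton (x := (1 : Circle)))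
    ⟨-1, by simp [Circle.ext_iff, neg_eq_iff_add_eq_zero]⟩
  exact hk rfl

/-! ### Quantum languages that are not `ω`-regular or `ω`-context-free -/

section Counterexamples

/-- The words `aᵐaᵖbᑫ` followed by the idle letter are accepted with a probability that depends on
the difference of the numbers of the letters `a` and `b`. -/
lemma append_replicate_mem_strictThresholdLanguageND_iff (z : Circle) (c : ℝ) (m p q : ℕ) :
    append (List.replicate m (some 0)) (append (List.replicate p (some 0))
      (append (List.replicate q (some 1)) fun _ => none)) ∈
        (phaseAutomaton (Fin 2) z).strictThresholdLanguageND c ↔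
      c < (‖1 + ((z ^ ((m : ℤ) + p - q) : Circle) : ℂ)‖ / 2) ^ 2 := by
  rw [← append_append, ← append_append]
  change c < (phaseAutomaton (Fin 2) z).acceptND _ ↔ _
  rw [phaseAutomaton_acceptND, inner_uniformState_phaseState]
  have h : (z : ℂ) ^ (m + p) + (z : ℂ) ^ q =
      (z : ℂ) ^ q * (1 + ((z ^ ((m : ℤ) + p - q) : Circle) : ℂ)) := by
    have hz := z.coe_ne_zero
    rw [Circle.coe_zpow, zpow_sub₀ hz, zpow_natCast, ← Nat.cast_add, zpow_natCast]
    field_simp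
    ring
  have hcount : ∑ i, (z : ℂ) ^ ((List.replicate m (some 0) ++ List.replicate p (some 0) ++
      List.replicate q (some 1) : List (Option (Fin 2))).count (some i)) =
      (z : ℂ) ^ (m + p) + (z : ℂ) ^ q := by
    simp [List.count_append, List.count_replicate]
  rw [hcount, h, norm_div, norm_mul, norm_pow, Circle.norm_coe, one_pow, one_mul]
  simp

/-- If the prefixes `aᵐ` and `aⁿ` were equivalent, acceptance would be periodic in the difference of
the counts. Difference `0` has probability `1 > c`, so all multiples of `n - m` would be accepted;
by density some multiple brings the phase close to `-1`, where the probability is below `c`. -/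
lemma exists_strictThresholdClassND_notMem_omegaRL {c : ℝ} (hc : c ∈ Set.Ioo (0 : ℝ) 1) :
    ∃ L ∈ strictThresholdClassND (Option (Fin 2)) c, L ∉ omegaRL (Option (Fin 2)) := by
  obtain ⟨z, hz⟩ := exists_circle_denseRange_zpow
  refine ⟨_, ⟨EuclideanSpace ℂ (Fin 2), _, _, inferInstance, phaseAutomaton (Fin 2) z, rfl⟩,
    fun hL => ?_⟩
  obtain ⟨m, n, hlt, hmn⟩ := exists_lt_replicate_of_mem_omegaRL hL (some 0)
  have hstep : ∀ e : ℤ, c < (‖1 + ((z ^ e : Circle) : ℂ)‖ / 2) ^ 2 ↔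
      c < (‖1 + ((z ^ (e + (n - m)) : Circle) : ℂ)‖ / 2) ^ 2 := fun e => by
    -- The truncated differences leave at most one block nonempty and make the total difference `e`,
    -- whatever its sign.
    have := hmn (append (List.replicate (e - m).toNat (some 0))
      (append (List.replicate (m - e).toNat (some 1)) fun _ => none))
    rw [append_replicate_mem_strictThresholdLanguageND_iff,
      append_replicate_mem_strictThresholdLanguageND_iff,
      show (m : ℤ) + ((e - m).toNat : ℤ) - ((m - e).toNat : ℤ) = e by omega,
      show (n : ℤ) + ((e - m).toNat : ℤ) - ((m - e).toNat : ℤ) = e + (n - m) by omega] at this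
    exact this
  have hall : ∀ k : ℤ, c < (‖1 + ((z ^ (((n : ℤ) - m) * k) : Circle) : ℂ)‖ / 2) ^ 2 := by
    intro k
    induction k using Int.induction_on with
    | zero =>
      have : (1 : ℂ) + 1 = 2 := by norm_num
      simp [this, hc.2]
    | succ k ih =>
      rw [mul_add, mul_one]
      exact (hstep _).1 ih
    | pred k ih =>
      rw [hstep, show ((n : ℤ) - m) * (-(k : ℤ) - 1) + (n - m) = (n - m) * -(k : ℤ) by ring]
      exact ih
  have hopen : IsOpen {x : Circle | (‖1 + (x : ℂ)‖ / 2) ^ 2 < c} :=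
    isOpen_lt (by fun_prop) continuous_const
  obtain ⟨k, hk⟩ := (hz (n - m) (by omega)).exists_mem_open hopen ⟨-1, by simpa using hc.1⟩
  exact lt_asymm hk (hall k)

/-- The word `aⁿbⁿcⁿ` followed by the idle letter. -/
def tripleWord (n : ℕ) : OmegaWord (Option (Fin 3)) :=
  append (List.replicate n (some 0)) (append (List.replicate n (some 1))
    (append (List.replicate n (some 2)) fun _ => none))

lemma tripleWord_apply (n i : ℕ) : tripleWord n i = if i < n then some 0 else
    if i < 2 * n then some 1 else if i < 3 * n then some 2 else none := by
  simp only [tripleWord, append_replicate_apply]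
  split_ifs <;> first | rfl | omega

lemma tripleWord_mem {z : Circle} (hz : Function.Injective fun n : ℕ => (z : ℂ) ^ n) (n : ℕ) :
    tripleWord n ∈ (phaseAutomaton (Fin 3) z).almostSureLanguageND := by
  rw [tripleWord, ← append_append, ← append_append, append_mem_almostSureLanguageND_iff hz]
  intro i j
  fin_cases i <;> fin_cases j <;> simp [List.count_replicate]

lemma almostSureLanguageND_notMem_omegaRL {z : Circle}
    (hz : Function.Injective fun n : ℕ => (z : ℂ) ^ n) :
    (phaseAutomaton (Fin 3) z).almostSureLanguageND ∉ omegaRL (Option (Fin 3)) := by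
  intro hL
  obtain ⟨m, n, hlt, hmn⟩ := exists_lt_replicate_of_mem_omegaRL hL (some 0)
  have h := (hmn _).1 (tripleWord_mem hz m)
  rw [← append_append, ← append_append, append_mem_almostSureLanguageND_iff hz] at h
  have := h 0 1
  simp [List.count_replicate] at this
  omega

/-- A factor of `aⁿbⁿcⁿ` that contains both `a` and `c` contains all the letters `b`. -/
lemma le_count_factor_tripleWord {n i j : ℕ}
    (h₀ : 0 < ((tripleWord n).factor i j).count (some 0))
    (h₂ : 0 < ((tripleWord n).factor i j).count (some 2)) :
    n ≤ ((tripleWord n).factor i j).count (some 1) := by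
  have hi : i ≤ n := by
    rw [List.count_pos_iff] at h₀
    simp only [factor, List.mem_map, List.mem_range'_1, tripleWord_apply] at h₀
    obtain ⟨k, hk, he⟩ := h₀
    split_ifs at he <;> simp_all
    omega
  have hj : 2 * n ≤ j := by
    rw [List.count_pos_iff] at h₂
    simp only [factor, List.mem_map, List.mem_range'_1, tripleWord_apply] at h₂
    obtain ⟨k, hk, he⟩ := h₂
    split_ifs at he <;> simp_all
    omega
  have hb : (tripleWord n).factor n (2 * n) = List.replicate n (some 1) := by
    rw [List.eq_replicate_iff]
    refine ⟨by simp; omega, fun x hx => ?_⟩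
    simp only [factor, List.mem_map, List.mem_range'_1, tripleWord_apply] at hx
    obtain ⟨k, hk, rfl⟩ := hx
    rw [if_neg (by omega), if_pos (by omega)]
  rw [← factor_append_factor _ (hi.trans (by omega)) hj, ← factor_append_factor _ hi (by omega), hb,
    List.count_append, List.count_append, List.count_replicate_self]
  omega

lemma almostSureLanguageND_notMem_omegaCFL {z : Circle}
    (hz : Function.Injective fun n : ℕ => (z : ℂ) ^ n) :
    (phaseAutomaton (Fin 3) z).almostSureLanguageND ∉ omegaCFL (Option (Fin 3)) := by
  intro hL
  obtain ⟨K, _, R, C, hR⟩ := exists_interchange_of_mem_omegaCFL hL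
  obtain ⟨D, hCD, hD⟩ : ∃ D, C ≤ D ∧ 1 ≤ D := ⟨max C 1, le_max_left _ _, le_max_right _ _⟩
  have := Fintype.ofFinite K
  -- This `n` exceeds `2 * D ^ j` at every scale used, and also the number of letters `b` in every
  -- chosen factor.
  obtain ⟨n, hn⟩ : ∃ n, n = 2 * D ^ (Fintype.card K + 1) + 1 := ⟨_, rfl⟩
  have hpow : ∀ j : Fin (Fintype.card K + 1), D ^ (j : ℕ) ≤ D ^ (Fintype.card K + 1) :=
    fun j => Nat.pow_le_pow_right hD (by omega)
  have hcount : n ≤ ((tripleWord n).factor 0 (2 * n + 1)).count (some 1) := by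
    rcases Nat.eq_zero_or_pos n with h | h
    · omega
    apply le_count_factor_tripleWord <;> rw [List.count_pos_iff] <;>
      simp only [factor, List.mem_map, List.mem_range'_1, tripleWord_apply]
    · exact ⟨0, by omega, by rw [if_pos h]⟩
    · exact ⟨2 * n, by omega, by rw [if_neg (by omega), if_neg (by omega), if_pos (by omega)]⟩
  -- One factor is taken at each of `|K| + 1` scales, so two of them share a class. Their counts of
  -- `b` lie in disjoint windows `(D ^ j, D ^ (j + 1)]` and hence differ.
  choose κ p x w hw hx hy hlo hhi using fun j : Fin (Fintype.card K + 1) =>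
    hR (some 1) (D ^ (j : ℕ)) (Nat.one_le_pow _ _ hD) (tripleWord n) (tripleWord_mem hz n)
      (2 * n + 1) (by have := hpow j; omega)
  have hhi' : ∀ j, (x j).count (some 1) ≤ D ^ ((j : ℕ) + 1) := fun j => by
    rw [pow_succ']
    exact (hhi j).trans (Nat.mul_le_mul_right _ hCD)
  obtain ⟨j, j', hne, hκ⟩ := Fintype.exists_ne_map_eq_of_card_lt κ (by simp)
  wlog hlt : j < j' generalizing j j'
  · exact this j' j hne.symm hκ.symm (lt_of_le_of_ne (not_lt.1 hlt) hne.symm)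
  have hxx : (x j).count (some 1) < (x j').count (some 1) :=
    ((hhi' j).trans (Nat.pow_le_pow_right hD hlt)).trans_lt (hlo j')
  -- The counting criterion needs a finite word followed by idle letters; beyond position `3 * n`
  -- the tail is idle.
  have ht : w j = append ((w j).factor 0 (3 * n)) fun _ => none := by
    conv_lhs => rw [← append_factor_drop (w j) (3 * n)]
    congr 1
    funext i
    have := append_apply_add (p j ++ x j) (w j) (3 * n + i)
    rw [append_append, ← hw j, tripleWord_apply, if_neg (by omega), if_neg (by omega),
      if_neg (by omega)] at this
    exact this.symm
  generalize (w j).factor 0 (3 * n) = t at ht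
  have h₁ := tripleWord_mem hz n
  rw [hw j, ht, ← append_append, ← append_append, append_mem_almostSureLanguageND_iff hz] at h₁
  have h₂ := hy j (x j') (hκ ▸ hx j')
  rw [ht, ← append_append, ← append_append, append_mem_almostSureLanguageND_iff hz] at h₂
  simp only [List.count_append] at h₁ h₂
  have h₃ : (tripleWord n).factor (p j').length ((p j').length + (x j').length) = x j' := by
    have := factor_append_add (p j') (append (x j') (w j')) 0 (x j').length
    rwa [← hw j', add_zero, factor_append] at this
  have h₄ := le_count_factor_tripleWord (n := n) (i := (p j').length)
    (j := (p j').length + (x j').length)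
  rw [h₃] at h₄
  -- The exchange adds letters `b`, so by equality of the counts before and after it adds letters
  -- `a` and `c` too; thus `x j'` contains both.
  have h₅ := h₄ (by have := h₁ 0 1; have := h₂ 0 1; omega)
    (by have := h₁ 2 1; have := h₂ 2 1; omega)
  have h₆ := hhi' j'
  have h₇ : D ^ ((j' : ℕ) + 1) ≤ D ^ (Fintype.card K + 1) := Nat.pow_le_pow_right hD (by omega)
  omega

end Counterexamples

/-! ### The theorem -/

theorem mainTheorem7 :
    (∃ (α : Type) (_ : Finite α), ∃ L ∈ omegaRL α,
      ∀ c ∈ Set.Ico (0 : ℝ) 1, L ∉ strictThresholdClassND α c) ∧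
    (∃ (α : Type) (_ : Finite α), ∃ L ∈ omegaCFL α \ omegaRL α,
      ∀ c ∈ Set.Ico (0 : ℝ) 1, L ∉ strictThresholdClassND α c) ∧
    (∀ c ∈ Set.Ioo (0 : ℝ) 1, ∃ (α : Type) (_ : Finite α),
      ∃ L ∈ strictThresholdClassND α c, L ∉ omegaRL α) ∧
    (∃ (α : Type) (_ : Finite α), ∃ L ∈ almostSureClassND α, L ∉ omegaRL α) ∧
    (∃ (α : Type) (_ : Finite α), ∃ L ∈ almostSureClassND α, L ∉ omegaRL α ∧ L ∉ omegaCFL α) := by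
  obtain ⟨z, hz⟩ := exists_circle_denseRange_zpow
  have hz' := injective_pow_of_denseRange_zpow hz
  have hmem : (phaseAutomaton (Fin 3) z).almostSureLanguageND ∈
      almostSureClassND (Option (Fin 3)) :=
    ⟨EuclideanSpace ℂ (Fin 3), _, _, inferInstance, _, rfl⟩
  exact ⟨⟨Bool, inferInstance, exists_omegaRL_notMem_strictThresholdClassND⟩,
    ⟨Bool, inferInstance, exists_omegaCFL_notMem_strictThresholdClassND⟩,
    fun c hc => ⟨_, inferInstance, exists_strictThresholdClassND_notMem_omegaRL hc⟩,
    ⟨_, inferInstance, _, hmem, almostSureLanguageND_notMem_omegaRL hz'⟩,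
    ⟨_, inferInstance, _, hmem, almostSureLanguageND_notMem_omegaRL hz',
      almostSureLanguageND_notMem_omegaCFL hz'⟩⟩
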